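/- All graphs are finite and simple. For a graph $G=(V,E)$, a set $D\subseteq V$ is dominating if every vertex of $V\setminus D$ has a neighbour in $D$, and $\gamma(G)$ denotes the minimum cardinality of a dominating set. For $F\subseteq E$, let $G_F$ be the graph obtained from $G$ by subdividing every edge of $F$ exactly once. The domination subdivision number $\mathrm{sd}(G)$ is the minimum of $|F|$ over all $F\subseteq E$ with $\gamma(G_F)>\gamma(G)$. For $q\ge 1$, the graph $G$ is called $q$-critical if $q$ is the smallest integer with $1\le q\le |E|$ such that $\gamma(G_F)>\gamma(G)$ for every $F\subseteq E$ with $|F|=q$. **Theorem.** Let $T$ be a finite tree. Then $T$ is $3$-critical and $\mathrm{sd}(T)=3$ if and only if $T$ is isomorphic to the path $P_{3k+1}$ on $3k+1$ vertices for some integer $k\ge 1$. -/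

import Mathlib

namespace DomSubdiv

variable {V : Type*}

/-- `D` is a dominating set of `G`: every vertex outside `D` has a neighbour in `D`. -/
def IsDominating (G : SimpleGraph V) (D : Finset V) : Prop :=
  ∀ v, v ∉ D → ∃ u ∈ D, G.Adj v u

/-- The domination number `γ(G)` of a finite graph: the minimum cardinality of a dominating set.
(The whole vertex set is dominating, so the minimum is over a nonempty set.) -/
noncomputable def dominationNumber (G : SimpleGraph V) : ℕ :=
  sInf {n | ∃ D : Finset V, IsDominating G D ∧ D.card = n}

/-- Adjacency in `G_F`: the old vertices are `Sum.inl v`, and the vertex subdividing the edge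
`e ∈ F` is `Sum.inr e`. The edges in `F` are deleted, and the new vertex of `e` is joined to
the two endpoints of `e`. -/
def subdivideAdj (G : SimpleGraph V) (F : Finset (Sym2 V)) : V ⊕ F → V ⊕ F → Prop
  | Sum.inl u, Sum.inl v => G.Adj u v ∧ s(u, v) ∉ F
  | Sum.inl u, Sum.inr e => u ∈ (e : Sym2 V)
  | Sum.inr e, Sum.inl u => u ∈ (e : Sym2 V)
  | Sum.inr _, Sum.inr _ => False

/-- The graph `G_F` obtained from `G` by subdividing (once) each edge of `F ⊆ E(G)`. -/
def subdivide (G : SimpleGraph V) (F : Finset (Sym2 V)) : SimpleGraph (V ⊕ F) where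
  Adj := subdivideAdj G F
  symm := ⟨by
    rintro (u | e) (v | f) h
    · exact ⟨h.1.symm, by rw [Sym2.eq_swap]; exact h.2⟩
    · exact h
    · exact h
    · exact h⟩
  loopless := ⟨by
    rintro (u | e) h
    · exact G.loopless.irrefl u h.1
    · exact h⟩

/-- The domination subdivision number `sd(G)`: the minimum number of edges that must be subdivided
(each at most once) in order to increase the domination number. When no set of edges does so, the
set below is empty and the value is the convention `0`, which no actual minimum takes. -/
noncomputable def sd (G : SimpleGraph V) : ℕ :=
  sInf {n | ∃ F : Finset (Sym2 V), (F : Set (Sym2 V)) ⊆ G.edgeSet ∧ F.card = n ∧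
    dominationNumber G < dominationNumber (subdivide G F)}

/-- Subdividing edges of `G` necessarily increases the domination number once their number is `q`:
`G` has at least `q` edges, and `γ(G_F) > γ(G)` for every set `F` of exactly `q` edges of `G`. -/
def NecessarilyIncreases (G : SimpleGraph V) (q : ℕ) : Prop :=
  (∃ F : Finset (Sym2 V), (F : Set (Sym2 V)) ⊆ G.edgeSet ∧ F.card = q) ∧
  ∀ F : Finset (Sym2 V), (F : Set (Sym2 V)) ⊆ G.edgeSet → F.card = q →
    dominationNumber G < dominationNumber (subdivide G F)

/-- `G` is `γ`-`q`-critical: `q ≥ 1` is the smallest number such that subdividing any `q` edges of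
`G` increases the domination number. -/
def IsCritical (G : SimpleGraph V) (q : ℕ) : Prop :=
  IsLeast {n | 1 ≤ n ∧ NecessarilyIncreases G n} q

end DomSubdiv

/-! Fix a vertex `v` of the tree. Deleting `v` leaves one branch for each neighbour `x`. Three costs
of that branch matter: `a_x` (`gammaFree`, where `x` may stay undominated), `b_x` (`gammaOn`) and
`c_x` (`gammaRoot`, where `x` is used), with `a_x ≤ b_x ≤ c_x`. Write `S` for the sum of the `a_x`.
Subdividing edges at `v` leaves the interiors of the branches intact, so the domination numbers
before and after are compared through `S` and the gaps `a < b`, `a < c`.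

The core is `degree_le_two`: if no two edges suffice to raise the domination number but every three
do, no vertex has degree at least 3. At a vertex of degree at least 3, each pattern of gaps gives a
contradiction. Either two suitable edges raise the number, or some three edges at `v` fail to raise
it.

A tree of maximum degree at most 2 is a path, and its subdivisions are again paths. A path on `n`
vertices has domination number `⌈n/3⌉`, so subdividing `m` edges gives `⌈(n+m)/3⌉`. The first
increase occurs at `m = 3` exactly when `n ≡ 1 (mod 3)`, and having three edges forces `n ≥ 4`. -/

namespace DomSubdiv
open scoped Classical
variable {V : Type*}

/-! ### Domination costs of a rooted vertex set -/

section

/-- The least cardinality of a finite set with property `P`. -/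
noncomputable def minCard (P : Finset V → Prop) : ℕ := sInf {n | ∃ D, P D ∧ D.card = n}

lemma minCard_le {P : Finset V → Prop} {D : Finset V} (h : P D) : minCard P ≤ D.card :=
  Nat.sInf_le ⟨D, h, rfl⟩

lemma exists_card_eq_minCard {P : Finset V → Prop} (h : ∃ D, P D) :
    ∃ D, P D ∧ D.card = minCard P :=
  let ⟨D, hD⟩ := h
  Nat.sInf_mem (s := {n | ∃ D, P D ∧ D.card = n}) ⟨D.card, D, hD, rfl⟩

lemma dominationNumber_le {G : SimpleGraph V} {D : Finset V} (h : IsDominating G D) :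
    dominationNumber G ≤ D.card :=
  Nat.sInf_le ⟨D, h, rfl⟩

lemma exists_isDominating_card_eq [Fintype V] (G : SimpleGraph V) :
    ∃ D, IsDominating G D ∧ D.card = dominationNumber G :=
  exists_card_eq_minCard (P := IsDominating G)
    ⟨Finset.univ, fun v hv => (hv (Finset.mem_univ v)).elim⟩

/-- `u` lies in `D` or has a neighbour in `D`. -/
def Covers (G : SimpleGraph V) (D : Finset V) (u : V) : Prop :=
  u ∈ D ∨ ∃ w ∈ D, G.Adj u w

lemma Covers.mono {G : SimpleGraph V} {D D' : Finset V} {u : V} (h : Covers G D u)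
    (hD : D ⊆ D') : Covers G D' u :=
  h.imp (fun h => hD h) fun ⟨w, hw, ha⟩ => ⟨w, hD hw, ha⟩

/-- The least size of a subset of `B` dominating `B`, except possibly its root `x`. -/
noncomputable def gammaFree (G : SimpleGraph V) (B : Finset V) (x : V) : ℕ :=
  minCard fun D => D ⊆ B ∧ ∀ u ∈ B, u ≠ x → Covers G D u

/-- The least size of a subset of `B` dominating `B`. -/
noncomputable def gammaOn (G : SimpleGraph V) (B : Finset V) : ℕ :=
  minCard fun D => D ⊆ B ∧ ∀ u ∈ B, Covers G D u

/-- The least size of a subset of `B` dominating `B` and containing the root `x`. -/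
noncomputable def gammaRoot (G : SimpleGraph V) (B : Finset V) (x : V) : ℕ :=
  minCard fun D => D ⊆ B ∧ x ∈ D ∧ ∀ u ∈ B, Covers G D u

section params
variable (G : SimpleGraph V) (B : Finset V) (x : V)

lemma exists_gammaFree : ∃ D, (D ⊆ B ∧ ∀ u ∈ B, u ≠ x → Covers G D u) ∧
    D.card = gammaFree G B x :=
  exists_card_eq_minCard ⟨B, subset_rfl, fun _ hu _ => Or.inl hu⟩

lemma exists_gammaOn : ∃ D, (D ⊆ B ∧ ∀ u ∈ B, Covers G D u) ∧ D.card = gammaOn G B :=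
  exists_card_eq_minCard ⟨B, subset_rfl, fun _ hu => Or.inl hu⟩

variable {B x} in
lemma exists_gammaRoot (hx : x ∈ B) :
    ∃ D, (D ⊆ B ∧ x ∈ D ∧ ∀ u ∈ B, Covers G D u) ∧ D.card = gammaRoot G B x :=
  exists_card_eq_minCard ⟨B, subset_rfl, hx, fun _ hu => Or.inl hu⟩

lemma gammaFree_le_gammaOn : gammaFree G B x ≤ gammaOn G B := by
  obtain ⟨D, hD, hc⟩ := exists_gammaOn G B
  rw [← hc]
  exact minCard_le ⟨hD.1, fun u hu _ => hD.2 u hu⟩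

variable {B x} in
lemma gammaOn_le_gammaRoot (hx : x ∈ B) : gammaOn G B ≤ gammaRoot G B x := by
  obtain ⟨D, hD, hc⟩ := exists_gammaRoot G hx
  rw [← hc]
  exact minCard_le ⟨hD.1, hD.2.2⟩

end params

/-! ### Branches of a tree -/

/-- In the tree `T`, the component of `x` after deletion of the edge `vx`. -/
noncomputable def branch [Fintype V] (T : SimpleGraph V) (v x : V) : Finset V :=
  Finset.univ.filter fun u => (T.deleteEdges {s(v, x)}).Reachable x u

section branch
variable [Fintype V] {T : SimpleGraph V} {v x y u w : V}

lemma mem_branch : u ∈ branch T v x ↔ (T.deleteEdges {s(v, x)}).Reachable x u := by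
  simp [branch]

lemma root_mem_branch : x ∈ branch T v x := mem_branch.2 (SimpleGraph.Reachable.refl _)

lemma not_mem_branch (hT : T.IsTree) (h : T.Adj v x) : v ∉ branch T v x := by
  intro hv
  have hb := (SimpleGraph.isAcyclic_iff_forall_adj_isBridge.1 hT.isAcyclic) h
  rw [SimpleGraph.isBridge_iff] at hb
  exact hb (mem_branch.1 hv).symm

lemma mem_branch_of_adj (hT : T.IsTree) (h : T.Adj v x) (hu : u ∈ branch T v x)
    (huw : T.Adj u w) : w ∈ branch T v x ∨ (u = x ∧ w = v) := by
  by_cases he : s(u, w) = s(v, x)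
  · rcases Sym2.eq_iff.1 he with ⟨rfl, rfl⟩ | ⟨rfl, rfl⟩
    · exact (not_mem_branch hT h hu).elim
    · exact Or.inr ⟨rfl, rfl⟩
  · left
    rw [mem_branch] at hu ⊢
    refine hu.trans (SimpleGraph.Adj.reachable ?_)
    simp [SimpleGraph.deleteEdges_adj, huw, he]

/-- Induction along the edges of a branch. -/
lemma branch_induction {p : V → Prop} (hx : p x)
    (hs : ∀ u w, u ∈ branch T v x → T.Adj u w → s(u, w) ≠ s(v, x) → p u → p w)
    (hu : u ∈ branch T v x) : p u := by
  have hr := mem_branch.1 hu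
  rw [SimpleGraph.reachable_iff_reflTransGen] at hr
  induction hr with
  | refl => exact hx
  | @tail b c hb hbc ih =>
    have hbm : b ∈ branch T v x := by
      rw [mem_branch, SimpleGraph.reachable_iff_reflTransGen]; exact hb
    rw [SimpleGraph.deleteEdges_adj] at hbc
    exact hs b c hbm hbc.1 hbc.2 (ih hbm)

lemma not_mem_branch_of_mem_branch (hT : T.IsTree) (hx : T.Adj v x) (hy : T.Adj v y)
    (hxy : x ≠ y) (hu : u ∈ branch T v x) : u ∉ branch T v y := by
  refine branch_induction (p := fun u => u ∉ branch T v y) ?_ ?_ hu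
  · intro h
    rcases mem_branch_of_adj hT hy h hx.symm with h | h
    · exact not_mem_branch hT hy h
    · exact hxy h.1
  · intro a b ha hab hne hna hb
    rcases mem_branch_of_adj hT hy hb hab.symm with h | h
    · exact hna h
    · exact not_mem_branch hT hx (h.2 ▸ ha)

lemma exists_mem_branch (hT : T.IsTree) (hu : u ≠ v) : ∃ x, T.Adj v x ∧ u ∈ branch T v x := by
  have hr := hT.connected.preconnected v u
  rw [SimpleGraph.reachable_iff_reflTransGen] at hr
  have key : u = v ∨ ∃ x, T.Adj v x ∧ u ∈ branch T v x := by
    clear hu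
    induction hr with
    | refl => exact Or.inl rfl
    | @tail b c _ hbc ih =>
      rcases ih with rfl | ⟨x, hx, hb⟩
      · exact Or.inr ⟨c, hbc, root_mem_branch⟩
      · rcases mem_branch_of_adj hT hx hb hbc with h | h
        · exact Or.inr ⟨x, hx, h⟩
        · exact Or.inl h.2
  exact key.resolve_left hu

/-- A common vertex of the two sides would reconnect `v` to `x`, although a tree edge is a bridge.
Conversely, a walk from `v` can change sides only across the edge `vx`, so the two sides exhaust the
tree. -/
lemma mem_branch_swap (hT : T.IsTree) (h : T.Adj v x) : u ∈ branch T v x ↔ u ∉ branch T x v := by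
  constructor
  · intro h1 h2
    refine not_mem_branch hT h (mem_branch.2 ?_)
    rw [mem_branch] at h1 h2
    rw [Sym2.eq_swap] at h2
    exact h1.trans h2.symm
  · intro h2
    have hr := hT.connected.preconnected v u
    rw [SimpleGraph.reachable_iff_reflTransGen] at hr
    have key : u ∈ branch T v x ∨ u ∈ branch T x v := by
      clear h2
      induction hr with
      | refl => exact Or.inr root_mem_branch
      | @tail b c _ hbc ih =>
        rcases ih with hb | hb
        · rcases mem_branch_of_adj hT h hb hbc with h' | h'
          · exact Or.inl h'
          · exact Or.inr (h'.2 ▸ root_mem_branch)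
        · rcases mem_branch_of_adj hT h.symm hb hbc with h' | h'
          · exact Or.inr h'
          · exact Or.inl (h'.2 ▸ root_mem_branch)
    exact key.resolve_right h2

lemma card_biUnion_branch (hT : T.IsTree) (v : V) (D N : Finset V)
    (hN : N ⊆ T.neighborFinset v) :
    (N.biUnion fun x => D ∩ branch T v x).card = ∑ x ∈ N, (D ∩ branch T v x).card := by
  refine Finset.card_biUnion fun x hx y hy hxy => ?_
  have hx' := (T.mem_neighborFinset v x).1 (hN hx)
  have hy' := (T.mem_neighborFinset v y).1 (hN hy)
  refine Finset.disjoint_left.2 fun u hu hu' => ?_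
  exact not_mem_branch_of_mem_branch hT hx' hy' hxy (Finset.mem_inter.1 hu).2
    (Finset.mem_inter.1 hu').2

lemma card_eq_sum_branch (hT : T.IsTree) (v : V) (D : Finset V) :
    D.card = (if v ∈ D then 1 else 0) + ∑ x ∈ T.neighborFinset v, (D ∩ branch T v x).card := by
  rw [← card_biUnion_branch hT v D _ subset_rfl]
  have hD : (T.neighborFinset v).biUnion (fun x => D ∩ branch T v x) = D.erase v := by
    ext u
    simp only [Finset.mem_biUnion, SimpleGraph.mem_neighborFinset, Finset.mem_inter,
      Finset.mem_erase]
    constructor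
    · rintro ⟨x, hx, hu, hb⟩
      exact ⟨fun h => not_mem_branch hT hx (h ▸ hb), hu⟩
    · rintro ⟨hu, hD⟩
      obtain ⟨x, hx, hb⟩ := exists_mem_branch hT hu
      exact ⟨x, hx, hD, hb⟩
  rw [hD]
  split_ifs with h
  · rw [add_comm, Finset.card_erase_add_one h]
  · rw [Finset.erase_eq_of_notMem h, zero_add]

lemma branch_subset_branch (hT : T.IsTree) (h : T.Adj v x) (hy : T.Adj x y) (hyv : y ≠ v) :
    branch T x y ⊆ branch T v x := fun _ hu =>
  (mem_branch_swap hT h).2 (not_mem_branch_of_mem_branch hT hy h.symm hyv hu)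

lemma exists_mem_branch_of_mem_branch (hT : T.IsTree) (h : T.Adj v x) (hu : u ∈ branch T v x)
    (hux : u ≠ x) : ∃ y, T.Adj x y ∧ y ≠ v ∧ u ∈ branch T x y := by
  obtain ⟨y, hy, hb⟩ := exists_mem_branch hT hux
  refine ⟨y, hy, ?_, hb⟩
  rintro rfl
  exact (mem_branch_swap hT h).1 hu hb

lemma card_inter_branch (hT : T.IsTree) (h : T.Adj v x) (D : Finset V) :
    (D ∩ branch T v x).card = (if x ∈ D then 1 else 0) +
      ∑ y ∈ (T.neighborFinset x).erase v, (D ∩ branch T x y).card := by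
  rw [← card_biUnion_branch hT x D _ (Finset.erase_subset _ _)]
  have hD : ((T.neighborFinset x).erase v).biUnion (fun y => D ∩ branch T x y) =
      (D ∩ branch T v x).erase x := by
    ext u
    simp only [Finset.mem_biUnion, SimpleGraph.mem_neighborFinset, Finset.mem_inter,
      Finset.mem_erase]
    constructor
    · rintro ⟨y, ⟨hyv, hy⟩, hu, hb⟩
      exact ⟨fun h => not_mem_branch hT hy (h ▸ hb), hu, branch_subset_branch hT h hy hyv hb⟩
    · rintro ⟨hu, hD, hb⟩
      obtain ⟨y, hy, hyv, hb⟩ := exists_mem_branch_of_mem_branch hT h hb hu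
      exact ⟨y, ⟨hyv, hy⟩, hD, hb⟩
  rw [hD]
  have hmem : x ∈ D ∩ branch T v x ↔ x ∈ D := by simp [root_mem_branch]
  split_ifs with hx
  · rw [add_comm, Finset.card_erase_add_one (hmem.2 hx)]
  · rw [Finset.erase_eq_of_notMem (mt hmem.1 hx), zero_add]

end branch

/-! ### Restricting a dominating set of a subdivision to a branch -/

section subdivided
variable [Fintype V] {T : SimpleGraph V} {v x u : V} {F : Finset (Sym2 V)} {D : Finset (V ⊕ F)}

/-- No edge of `F` meets the branch of `x` at `v` outside its root `x`. -/
def AvoidsBranch (T : SimpleGraph V) (F : Finset (Sym2 V)) (v x : V) : Prop :=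
  ∀ e ∈ F, ∀ u ∈ e, u ∈ branch T v x → u = x

/-- `x` is dominated by `v` or by a subdivision vertex of `F`. -/
def DominatedOutside (D : Finset (V ⊕ F)) (v x : V) : Prop :=
  (Sum.inl v ∈ D ∧ s(v, x) ∉ F) ∨ ∃ e : F, x ∈ (e : Sym2 V) ∧ Sum.inr e ∈ D

/-- No edge inside the branch is subdivided, and only the root has neighbours outside it. The trace
of `D` therefore does all the work, except possibly at `x`. The three cost bounds below follow from
this. -/
lemma covers_or_dominatedOutside (hT : T.IsTree) (hvx : T.Adj v x) (hF : AvoidsBranch T F v x)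
    (hD : IsDominating (subdivide T F) D) (hu : u ∈ branch T v x) :
    Covers T (D.toLeft ∩ branch T v x) u ∨ (u = x ∧ DominatedOutside D v x) := by
  by_cases huD : Sum.inl u ∈ D
  · exact Or.inl (Or.inl (by simp [huD, hu]))
  obtain ⟨w | e, hw, ha⟩ := hD _ huD
  · have ha : T.Adj u w ∧ s(u, w) ∉ F := ha
    rcases mem_branch_of_adj hT hvx hu ha.1 with hb | ⟨rfl, rfl⟩
    · exact Or.inl (Or.inr ⟨w, by simp [hw, hb], ha.1⟩)
    · exact Or.inr ⟨rfl, Or.inl ⟨hw, by rw [Sym2.eq_swap]; exact ha.2⟩⟩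
  · have ha : u ∈ (e : Sym2 V) := ha
    obtain rfl := hF e e.2 u ha hu
    exact Or.inr ⟨rfl, Or.inr ⟨e, ha, hw⟩⟩

lemma gammaFree_le_card (hT : T.IsTree) (hvx : T.Adj v x) (hF : AvoidsBranch T F v x)
    (hD : IsDominating (subdivide T F) D) :
    gammaFree T (branch T v x) x ≤ (D.toLeft ∩ branch T v x).card :=
  minCard_le ⟨Finset.inter_subset_right, fun _ hu hux =>
    (covers_or_dominatedOutside hT hvx hF hD hu).resolve_right fun h => hux h.1⟩

lemma gammaOn_le_card (hT : T.IsTree) (hvx : T.Adj v x) (hF : AvoidsBranch T F v x)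
    (hD : IsDominating (subdivide T F) D) (hx : ¬ DominatedOutside D v x) :
    gammaOn T (branch T v x) ≤ (D.toLeft ∩ branch T v x).card :=
  minCard_le ⟨Finset.inter_subset_right, fun _ hu =>
    (covers_or_dominatedOutside hT hvx hF hD hu).resolve_right fun h => hx h.2⟩

lemma gammaRoot_le_card (hT : T.IsTree) (hvx : T.Adj v x) (hF : AvoidsBranch T F v x)
    (hD : IsDominating (subdivide T F) D) (hx : Sum.inl x ∈ D) :
    gammaRoot T (branch T v x) x ≤ (D.toLeft ∩ branch T v x).card := by
  have hx' : x ∈ D.toLeft ∩ branch T v x := by simp [hx, root_mem_branch]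
  refine minCard_le ⟨Finset.inter_subset_right, hx', fun u hu => ?_⟩
  rcases covers_or_dominatedOutside hT hvx hF hD hu with h | h
  · exact h
  · exact Or.inl (h.1 ▸ hx')

omit [Fintype V] in
-- A subdivision vertex has only the two ends of its edge as neighbours. In the lower bounds below,
-- each of the three outcomes is shown to cost an extra vertex.
lemma subdivision_vertex_cases (hD : IsDominating (subdivide T F) D) (e : s(v, x) ∈ F) :
    Sum.inr ⟨s(v, x), e⟩ ∈ D ∨ Sum.inl v ∈ D ∨ Sum.inl x ∈ D := by
  by_cases h : (Sum.inr ⟨s(v, x), e⟩ : V ⊕ F) ∈ D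
  · exact Or.inl h
  obtain ⟨w | f, hw, ha⟩ := hD _ h
  · have ha : w ∈ s(v, x) := ha
    rcases Sym2.mem_iff.1 ha with rfl | rfl
    · exact Or.inr (Or.inl hw)
    · exact Or.inr (Or.inr hw)
  · exact ha.elim

/-- This lets lower bounds proved for subdivisions be applied to `T` itself. -/
lemma dominationNumber_subdivide_empty_le (T : SimpleGraph V) :
    dominationNumber (subdivide T ∅) ≤ dominationNumber T := by
  obtain ⟨D, hD, hc⟩ := exists_isDominating_card_eq T
  rw [← hc]
  refine (dominationNumber_le (D := D.disjSum ∅) ?_).trans (by simp)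
  rintro (u | e) hu
  · obtain ⟨w, hw, ha⟩ := hD u (by simpa using hu)
    exact ⟨Sum.inl w, by simpa using hw, ha, by simp⟩
  · exact (Finset.notMem_empty _ e.2).elim

end subdivided

end

/-! ### Domination numbers in terms of branch costs -/

section

lemma add_two_le_sum {s : Finset V} {f g : V → ℕ} {x y : V} (h : ∀ z ∈ s, f z ≤ g z)
    (hx : x ∈ s) (hy : y ∈ s) (hxy : x ≠ y) (hfx : f x < g x) (hfy : f y < g y) :
    ∑ z ∈ s, f z + 2 ≤ ∑ z ∈ s, g z := by
  have hy' : y ∈ s.erase x := Finset.mem_erase.2 ⟨hxy.symm, hy⟩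
  have h1 : ∑ z ∈ s.erase x, f z < ∑ z ∈ s.erase x, g z :=
    Finset.sum_lt_sum (fun z hz => h z (Finset.mem_of_mem_erase hz)) ⟨y, hy', hfy⟩
  rw [← Finset.add_sum_erase s f hx, ← Finset.add_sum_erase s g hx]
  omega

variable [Fintype V] {T : SimpleGraph V} {v x y x₁ x₂ : V} {X : Finset V}

lemma card_eq_of_subdivide (hT : T.IsTree) (v : V) {F : Finset (Sym2 V)} (D : Finset (V ⊕ F)) :
    D.card = (if Sum.inl v ∈ D then 1 else 0) +
      ∑ x ∈ T.neighborFinset v, (D.toLeft ∩ branch T v x).card + D.toRight.card := by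
  rw [← Finset.card_toLeft_add_card_toRight, card_eq_sum_branch hT v D.toLeft]
  simp

lemma avoidsBranch_image (hT : T.IsTree) (hX : X ⊆ T.neighborFinset v) (hx : T.Adj v x) :
    AvoidsBranch T (X.image fun z => s(v, z)) v x := by
  intro e he u hu hb
  obtain ⟨z, hz, rfl⟩ := Finset.mem_image.1 he
  rcases Sym2.mem_iff.1 hu with rfl | rfl
  · exact (not_mem_branch hT hx hb).elim
  · by_contra hne
    exact not_mem_branch_of_mem_branch hT ((T.mem_neighborFinset _ _).1 (hX hz)) hx hne
      root_mem_branch hb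

lemma image_edge_subset (hX : X ⊆ T.neighborFinset v) :
    ((X.image fun z => s(v, z) : Finset (Sym2 V)) : Set (Sym2 V)) ⊆ T.edgeSet := by
  intro e he
  obtain ⟨z, hz, rfl⟩ := Finset.mem_image.1 (Finset.mem_coe.1 he)
  exact (T.mem_neighborFinset _ _).1 (hX hz)

omit [Fintype V] in
lemma card_image_edge (v : V) (X : Finset V) : (X.image fun z => s(v, z)).card = X.card :=
  Finset.card_image_of_injective _ fun _ _ h => Sym2.congr_right.1 h

/-- If all edges of `F` are at `v`, domination inside a branch at `v` survives subdividing `F`. -/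
lemma exists_adj_of_covers (hT : T.IsTree) {F : Finset (Sym2 V)} (hF : ∀ e ∈ F, v ∈ e)
    (hx : T.Adj v x) {E : Finset V} (hE : E ⊆ branch T v x) {D : Finset (V ⊕ F)}
    (hD : ∀ u ∈ E, Sum.inl u ∈ D) {u : V} (hu : u ∈ branch T v x) (hc : Covers T E u)
    (huD : Sum.inl u ∉ D) : ∃ w ∈ D, (subdivide T F).Adj (Sum.inl u) w := by
  rcases hc with h | ⟨w, hw, ha⟩
  · exact (huD (hD u h)).elim
  · refine ⟨Sum.inl w, hD w hw, ha, fun h => ?_⟩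
    rcases Sym2.mem_iff.1 (hF _ h) with rfl | rfl
    · exact not_mem_branch hT hx hu
    · exact not_mem_branch hT hx (hE hw)

/-- The vertex `v` dominates every root left undominated in its branch. -/
lemma dominationNumber_le_one_add (hT : T.IsTree) (v : V) :
    dominationNumber T ≤ ∑ x ∈ T.neighborFinset v, gammaFree T (branch T v x) x + 1 := by
  choose E hE hc using fun x => exists_gammaFree T (branch T v x) x
  refine (dominationNumber_le (D := insert v ((T.neighborFinset v).biUnion E)) ?_).trans
    ((Finset.card_insert_le _ _).trans (Nat.add_le_add_right
      (Finset.card_biUnion_le.trans (Finset.sum_le_sum fun x _ => (hc x).le)) 1))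
  intro u hu
  have huv : u ≠ v := fun h => hu (h ▸ Finset.mem_insert_self _ _)
  obtain ⟨x, hx, hb⟩ := exists_mem_branch hT huv
  by_cases hux : u = x
  · exact ⟨v, Finset.mem_insert_self _ _, hux ▸ hx.symm⟩
  · refine (((hE x).2 u hb hux).mono ?_).resolve_left hu
    exact (Finset.subset_biUnion_of_mem E ((T.mem_neighborFinset _ _).2 hx)).trans
      (Finset.subset_insert _ _)

/-- When no branch has the gap `a < b`, a branch with `c_x = a_x` can use its root for free, and
this root dominates `v`. -/
lemma dominationNumber_le_sum (hT : T.IsTree)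
    (hb : ∀ x ∈ T.neighborFinset v, gammaOn T (branch T v x) = gammaFree T (branch T v x) x)
    (hx : T.Adj v x) (hc : gammaRoot T (branch T v x) x = gammaFree T (branch T v x) x) :
    dominationNumber T ≤ ∑ x ∈ T.neighborFinset v, gammaFree T (branch T v x) x := by
  have hex : ∀ z, ∃ E, (E ⊆ branch T v z ∧ ∀ u ∈ branch T v z, Covers T E u) ∧
      (z = x → x ∈ E) ∧ (T.Adj v z → E.card = gammaFree T (branch T v z) z) := by
    intro z
    by_cases hz : z = x
    · subst hz
      obtain ⟨E, hE, hEc⟩ := exists_gammaRoot T (root_mem_branch (T := T) (v := v) (x := z))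
      exact ⟨E, ⟨hE.1, hE.2.2⟩, fun _ => hE.2.1, fun _ => hEc.trans hc⟩
    · obtain ⟨E, hE, hEc⟩ := exists_gammaOn T (branch T v z)
      exact ⟨E, hE, fun h => (hz h).elim,
        fun h => hEc.trans (hb z ((T.mem_neighborFinset _ _).2 h))⟩
  choose E hE hroot hcard using hex
  refine (dominationNumber_le (D := (T.neighborFinset v).biUnion E) ?_).trans
    (Finset.card_biUnion_le.trans (Finset.sum_le_sum fun x hx =>
      (hcard x ((T.mem_neighborFinset _ _).1 hx)).le))
  intro u hu
  by_cases huv : u = v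
  · exact ⟨x, Finset.mem_biUnion.2 ⟨x, (T.mem_neighborFinset _ _).2 hx, hroot x rfl⟩, huv ▸ hx⟩
  · obtain ⟨z, hz, hb⟩ := exists_mem_branch hT huv
    exact (((hE z).2 u hb).mono
      (Finset.subset_biUnion_of_mem E ((T.mem_neighborFinset _ _).2 hz))).resolve_left hu

/-- A dominating set avoiding `v` cannot leave any root to `v`, and must use some root to dominate
`v`. Under either hypothesis some branch then exceeds its cost `a`. -/
lemma add_one_le_dominationNumber (hT : T.IsTree)
    (h : (∃ x, T.Adj v x ∧ gammaFree T (branch T v x) x < gammaOn T (branch T v x)) ∨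
      ∀ x, T.Adj v x → gammaFree T (branch T v x) x < gammaRoot T (branch T v x) x) :
    ∑ x ∈ T.neighborFinset v, gammaFree T (branch T v x) x + 1 ≤ dominationNumber T := by
  refine le_trans ?_ (dominationNumber_subdivide_empty_le T)
  obtain ⟨D, hD, hc⟩ := exists_isDominating_card_eq (subdivide T ∅)
  rw [← hc, card_eq_of_subdivide hT v D]
  have hav : ∀ x, AvoidsBranch T ∅ v x := fun x e he => (Finset.notMem_empty e he).elim
  have hle : ∀ x ∈ T.neighborFinset v,
      gammaFree T (branch T v x) x ≤ (D.toLeft ∩ branch T v x).card := fun x hx =>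
    gammaFree_le_card hT ((T.mem_neighborFinset _ _).1 hx) (hav x) hD
  by_cases hv : Sum.inl v ∈ D
  · have := Finset.sum_le_sum hle
    rw [if_pos hv]
    omega
  · have hlt : ∃ x ∈ T.neighborFinset v,
        gammaFree T (branch T v x) x < (D.toLeft ∩ branch T v x).card := by
      rcases h with ⟨x, hx, hlt⟩ | h
      · refine ⟨x, (T.mem_neighborFinset _ _).2 hx,
          hlt.trans_le (gammaOn_le_card hT hx (hav x) hD ?_)⟩
        rintro (h | ⟨e, -⟩)
        · exact hv h.1
        · exact (Finset.notMem_empty _ e.2).elim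
      · obtain ⟨x | e, hw, ha⟩ := hD _ hv
        · have hx : T.Adj v x := ha.1
          exact ⟨x, (T.mem_neighborFinset _ _).2 hx,
            (h x hx).trans_le (gammaRoot_le_card hT hx (hav x) hD hw)⟩
        · exact (Finset.notMem_empty _ e.2).elim
    have := Finset.sum_lt_sum hle hlt
    omega

/-- The vertex `v` dominates all subdivision vertices, while each branch dominates itself at cost `b
= a`. -/
lemma dominationNumber_subdivide_le_of_center (hT : T.IsTree)
    (hb : ∀ x, T.Adj v x → gammaOn T (branch T v x) = gammaFree T (branch T v x) x) :
    dominationNumber (subdivide T (X.image fun z => s(v, z))) ≤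
      ∑ x ∈ T.neighborFinset v, gammaFree T (branch T v x) x + 1 := by
  choose E hE hc using fun x => exists_gammaOn T (branch T v x)
  refine (dominationNumber_le
    (D := (insert v ((T.neighborFinset v).biUnion E)).disjSum ∅) ?_).trans ?_
  · rintro (u | ⟨e, he⟩) hu
    · have huv : u ≠ v := fun h => hu (by simp [h])
      obtain ⟨x, hx, hbr⟩ := exists_mem_branch hT huv
      refine exists_adj_of_covers hT ?_ hx (hE x).1 ?_ hbr ((hE x).2 u hbr) hu
      · intro e he
        obtain ⟨z, -, rfl⟩ := Finset.mem_image.1 he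
        simp
      · intro w hw
        rw [Finset.inl_mem_disjSum]
        exact Finset.mem_insert_of_mem
          (Finset.mem_biUnion.2 ⟨x, (T.mem_neighborFinset _ _).2 hx, hw⟩)
    · refine ⟨Sum.inl v, by simp, ?_⟩
      obtain ⟨z, -, rfl⟩ := Finset.mem_image.1 he
      exact Sym2.mem_mk_left v z
  · rw [Finset.card_disjSum, Finset.card_empty, add_zero]
    exact (Finset.card_insert_le _ _).trans (Nat.add_le_add_right
      (Finset.card_biUnion_le.trans (Finset.sum_le_sum fun x hx =>
        ((hc x).trans (hb x ((T.mem_neighborFinset _ _).1 hx))).le)) 1)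

/-- The subdivision vertex of `vx` dominates both `v` and `x`. Every other root is used at no extra
cost and dominates the subdivision vertex on its edge. -/
lemma dominationNumber_subdivide_le_of_edge (hT : T.IsTree) (hX : X ⊆ T.neighborFinset v)
    (hx : x ∈ X)
    (hb : ∀ z, T.Adj v z → z ≠ x →
      gammaRoot T (branch T v z) z = gammaFree T (branch T v z) z) :
    dominationNumber (subdivide T (X.image fun z => s(v, z))) ≤
      ∑ x ∈ T.neighborFinset v, gammaFree T (branch T v x) x + 1 := by
  have hex : ∀ z, ∃ E, (E ⊆ branch T v z ∧ ∀ u ∈ branch T v z, u ≠ x → Covers T E u) ∧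
      (z ≠ x → z ∈ E) ∧ (T.Adj v z → E.card = gammaFree T (branch T v z) z) := by
    intro z
    by_cases hz : z = x
    · subst hz
      obtain ⟨E, hE, hEc⟩ := exists_gammaFree T (branch T v z) z
      exact ⟨E, hE, fun h => (h rfl).elim, fun _ => hEc⟩
    · obtain ⟨E, hE, hEc⟩ := exists_gammaRoot T (root_mem_branch (T := T) (v := v) (x := z))
      exact ⟨E, ⟨hE.1, fun u hu _ => hE.2.2 u hu⟩, fun _ => hE.2.1,
        fun h => hEc.trans (hb z h hz)⟩
  choose E hE hroot hcard using hex
  have hmem : s(v, x) ∈ X.image fun z => s(v, z) := Finset.mem_image_of_mem _ hx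
  refine (dominationNumber_le
    (D := ((T.neighborFinset v).biUnion E).disjSum {⟨s(v, x), hmem⟩}) ?_).trans ?_
  · rintro (u | ⟨e, he⟩) hu
    · by_cases huv : u = v
      · exact ⟨Sum.inr ⟨s(v, x), hmem⟩, by simp, huv ▸ Sym2.mem_mk_left v x⟩
      by_cases hux : u = x
      · exact ⟨Sum.inr ⟨s(v, x), hmem⟩, by simp, hux ▸ Sym2.mem_mk_right v u⟩
      obtain ⟨z, hz, hbr⟩ := exists_mem_branch hT huv
      refine exists_adj_of_covers hT ?_ hz (hE z).1 ?_ hbr ((hE z).2 u hbr hux) hu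
      · intro e he
        obtain ⟨z, -, rfl⟩ := Finset.mem_image.1 he
        simp
      · intro w hw
        rw [Finset.inl_mem_disjSum]
        exact Finset.mem_biUnion.2 ⟨z, (T.mem_neighborFinset _ _).2 hz, hw⟩
    · obtain ⟨z, hz, rfl⟩ := Finset.mem_image.1 he
      have hzx : z ≠ x := by
        rintro rfl
        simp at hu
      refine ⟨Sum.inl z, ?_, Sym2.mem_mk_right v z⟩
      rw [Finset.inl_mem_disjSum]
      exact Finset.mem_biUnion.2 ⟨z, hX hz, hroot z hzx⟩
  · rw [Finset.card_disjSum, Finset.card_singleton]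
    exact Nat.add_le_add_right (Finset.card_biUnion_le.trans (Finset.sum_le_sum fun x hx =>
      (hcard x ((T.mem_neighborFinset _ _).1 hx)).le)) 1

/-- Each subdivided edge forces its own unit beyond `S`. If the subdivision vertex of `vx₁` is
absent, `x₁` has to be dominated from within its branch, which costs a unit since `a < b`.
Dominating the subdivision vertex of `vx₂` takes a subdivision vertex, `v`, or the root `x₂`, the
last being paid for by `a < c`. -/
lemma add_two_le_dominationNumber_subdivide (hT : T.IsTree) (h₁ : T.Adj v x₁)
    (h₂ : T.Adj v x₂) (hne : x₁ ≠ x₂)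
    (hb : gammaFree T (branch T v x₁) x₁ < gammaOn T (branch T v x₁))
    (hc : gammaFree T (branch T v x₂) x₂ < gammaRoot T (branch T v x₂) x₂) :
    ∑ x ∈ T.neighborFinset v, gammaFree T (branch T v x) x + 2 ≤
      dominationNumber (subdivide T (({x₁, x₂} : Finset V).image fun z => s(v, z))) := by
  have hX : {x₁, x₂} ⊆ T.neighborFinset v := by
    intro z hz
    rcases Finset.mem_insert.1 hz with rfl | hz
    · simpa using h₁
    · rw [Finset.mem_singleton.1 hz]
      simpa using h₂
  obtain ⟨D, hD, hcard⟩ :=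
    exists_isDominating_card_eq (subdivide T (({x₁, x₂} : Finset V).image fun z => s(v, z)))
  rw [← hcard, card_eq_of_subdivide hT v D]
  have hle : ∀ z ∈ T.neighborFinset v,
      gammaFree T (branch T v z) z ≤ (D.toLeft ∩ branch T v z).card := fun z hz =>
    gammaFree_le_card hT ((T.mem_neighborFinset _ _).1 hz)
      (avoidsBranch_image hT hX ((T.mem_neighborFinset _ _).1 hz)) hD
  have hsum := Finset.sum_le_sum hle
  have hm₁ : s(v, x₁) ∈ ({x₁, x₂} : Finset V).image fun z => s(v, z) :=
    Finset.mem_image_of_mem _ (by simp)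
  have hm₂ : s(v, x₂) ∈ ({x₁, x₂} : Finset V).image fun z => s(v, z) :=
    Finset.mem_image_of_mem _ (by simp)
  have hn₁ := (T.mem_neighborFinset _ _).2 h₁
  have hn₂ := (T.mem_neighborFinset _ _).2 h₂
  have hpos : ∀ e, Sum.inr e ∈ D → 0 < D.toRight.card := fun e he =>
    Finset.card_pos.2 ⟨e, Finset.mem_toRight.2 he⟩
  by_cases hs : Sum.inr ⟨s(v, x₁), hm₁⟩ ∈ D
  · have := hpos _ hs
    rcases subdivision_vertex_cases hD hm₂ with h | h | h
    · have : 1 < D.toRight.card := Finset.one_lt_card.2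
        ⟨_, Finset.mem_toRight.2 hs, _, Finset.mem_toRight.2 h, fun he =>
            hne (Sym2.congr_right.1 (congrArg Subtype.val he))⟩
      omega
    · rw [if_pos h]
      omega
    · have := Finset.sum_lt_sum hle ⟨x₂, hn₂,
        hc.trans_le (gammaRoot_le_card hT h₂ (avoidsBranch_image hT hX h₂) hD h)⟩
      omega
  · have hout : ¬ DominatedOutside D v x₁ := by
      rintro (h | ⟨⟨e, he⟩, hx, h⟩)
      · exact h.2 hm₁
      · obtain ⟨z, hz, rfl⟩ := Finset.mem_image.1 he
        rcases Sym2.mem_iff.1 hx with rfl | rfl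
        · exact h₁.ne rfl
        · exact hs h
    have hlt₁ := hb.trans_le (gammaOn_le_card hT h₁ (avoidsBranch_image hT hX h₁) hD hout)
    have hlt := Finset.sum_lt_sum hle ⟨x₁, hn₁, hlt₁⟩
    rcases subdivision_vertex_cases hD hm₂ with h | h | h
    · have := hpos _ h
      omega
    · rw [if_pos h]
      omega
    · have := add_two_le_sum hle hn₁ hn₂ hne hlt₁
        (hc.trans_le (gammaRoot_le_card hT h₂ (avoidsBranch_image hT hX h₂) hD h))
      omega

/-- The root `x` dominates the roots of all its child branches. -/
lemma gammaFree_branch_le (hT : T.IsTree) (h : T.Adj v x) :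
    gammaFree T (branch T v x) x ≤
      ∑ y ∈ (T.neighborFinset x).erase v, gammaFree T (branch T x y) y + 1 := by
  choose E hE hc using fun y => exists_gammaFree T (branch T x y) y
  have hN : ∀ y ∈ (T.neighborFinset x).erase v, y ≠ v ∧ T.Adj x y := by simp
  refine (minCard_le (D := insert x (((T.neighborFinset x).erase v).biUnion E)) ⟨?_, ?_⟩).trans
    ((Finset.card_insert_le _ _).trans (Nat.add_le_add_right
      (Finset.card_biUnion_le.trans (Finset.sum_le_sum fun x _ => (hc x).le)) 1))
  · refine Finset.insert_subset root_mem_branch (Finset.biUnion_subset.2 fun y hy => ?_)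
    exact (hE y).1.trans (branch_subset_branch hT h (hN y hy).2 (hN y hy).1)
  · intro u hu hux
    obtain ⟨y, hy, hyv, hb⟩ := exists_mem_branch_of_mem_branch hT h hu hux
    by_cases huy : u = y
    · exact Or.inr ⟨x, Finset.mem_insert_self _ _, huy ▸ hy.symm⟩
    · exact ((hE y).2 u hb huy).mono ((Finset.subset_biUnion_of_mem E
        (by simp [hy, hyv])).trans (Finset.subset_insert _ _))

/-- If all child branches had `a_y = b_y`, dominating each separately would cover everything but
`x`, so `a_x` would be at most the sum of the `a_y`. A set using `x` costs at least one more than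
that sum, contradicting `c_x = a_x`. -/
lemma exists_gammaFree_lt_gammaOn (hT : T.IsTree) (h : T.Adj v x)
    (hc : gammaRoot T (branch T v x) x = gammaFree T (branch T v x) x) :
    ∃ y, T.Adj x y ∧ y ≠ v ∧ gammaFree T (branch T x y) y < gammaOn T (branch T x y) := by
  by_contra! hcon
  have hN : ∀ y ∈ (T.neighborFinset x).erase v, y ≠ v ∧ T.Adj x y := by simp
  have h1 : gammaFree T (branch T v x) x ≤
      ∑ y ∈ (T.neighborFinset x).erase v, gammaFree T (branch T x y) y := by
    choose E hE hEc using fun y => exists_gammaOn T (branch T x y)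
    refine (minCard_le (D := ((T.neighborFinset x).erase v).biUnion E) ⟨?_, ?_⟩).trans
      (Finset.card_biUnion_le.trans (Finset.sum_le_sum fun y hy =>
        (hEc y).le.trans (hcon y (hN y hy).2 (hN y hy).1)))
    · refine Finset.biUnion_subset.2 fun y hy => ?_
      exact (hE y).1.trans (branch_subset_branch hT h (hN y hy).2 (hN y hy).1)
    · intro u hu hux
      obtain ⟨y, hy, hyv, hb⟩ := exists_mem_branch_of_mem_branch hT h hu hux
      exact ((hE y).2 u hb).mono (Finset.subset_biUnion_of_mem E (by simp [hy, hyv]))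
  obtain ⟨D, hD, hDc⟩ := exists_gammaRoot T (root_mem_branch (T := T) (v := v) (x := x))
  have h2 := card_inter_branch hT h D
  rw [Finset.inter_eq_left.2 hD.1, if_pos hD.2.1, hDc] at h2
  have h3 : ∑ y ∈ (T.neighborFinset x).erase v, gammaFree T (branch T x y) y ≤
      ∑ y ∈ (T.neighborFinset x).erase v, (D ∩ branch T x y).card := by
    refine Finset.sum_le_sum fun y hy => minCard_le ⟨Finset.inter_subset_right, ?_⟩
    intro u hu huy
    rcases hD.2.2 u (branch_subset_branch hT h (hN y hy).2 (hN y hy).1 hu) with h' | ⟨w, hw, ha⟩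
    · exact Or.inl (Finset.mem_inter.2 ⟨h', hu⟩)
    · refine Or.inr ⟨w, Finset.mem_inter.2 ⟨hw, ?_⟩, ha⟩
      exact (mem_branch_of_adj hT (hN y hy).2 hu ha).resolve_right fun h => huy h.1
  omega

/-- The branch of `x` is split once more at `x`. Since `a_x` is at most one more than the sum of its
child costs, two units beyond the refined sum are needed. One comes from the subdivision vertex of
`xy` or the gap `a < b` at `y`, the other from dominating the subdivision vertex of `vx`. -/
lemma add_one_le_dominationNumber_subdivide_path (hT : T.IsTree) (hx : T.Adj v x)
    (hy : T.Adj x y) (hyv : y ≠ v)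
    (hb : gammaFree T (branch T x y) y < gammaOn T (branch T x y)) :
    ∑ x ∈ T.neighborFinset v, gammaFree T (branch T v x) x + 1 ≤
      dominationNumber (subdivide T {s(v, x), s(x, y)}) := by
  obtain ⟨D, hD, hcard⟩ := exists_isDominating_card_eq (subdivide T {s(v, x), s(x, y)})
  have hN : ∀ y ∈ (T.neighborFinset x).erase v, y ≠ v ∧ T.Adj x y := by simp
  have hnv : x ∈ T.neighborFinset v := (T.mem_neighborFinset _ _).2 hx
  rw [← hcard, card_eq_of_subdivide hT v D, ← Finset.add_sum_erase _ _ hnv,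
    ← Finset.add_sum_erase _ _ hnv, card_inter_branch hT hx]
  have hav₁ : ∀ z, T.Adj v z → z ≠ x → AvoidsBranch T {s(v, x), s(x, y)} v z := by
    intro z hz hzx e he u hu hbr
    exfalso
    have hxz {a} := not_mem_branch_of_mem_branch (u := a) hT hx hz hzx.symm
    simp only [Finset.mem_insert, Finset.mem_singleton] at he
    rcases he with rfl | rfl <;> rcases Sym2.mem_iff.1 hu with rfl | rfl
    · exact not_mem_branch hT hz hbr
    · exact hxz root_mem_branch hbr
    · exact hxz root_mem_branch hbr
    · exact hxz (branch_subset_branch hT hx hy hyv root_mem_branch) hbr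
  have hav₂ : ∀ z, T.Adj x z → z ≠ v → AvoidsBranch T {s(v, x), s(x, y)} x z := by
    intro z hz hzv e he u hu hbr
    simp only [Finset.mem_insert, Finset.mem_singleton] at he
    rcases he with rfl | rfl <;> rcases Sym2.mem_iff.1 hu with rfl | rfl
    · exact (not_mem_branch_of_mem_branch hT hx.symm hz hzv.symm root_mem_branch hbr).elim
    · exact (not_mem_branch hT hz hbr).elim
    · exact (not_mem_branch hT hz hbr).elim
    · by_contra hne
      exact not_mem_branch_of_mem_branch hT hy hz hne root_mem_branch hbr
  have hsum₁ : ∑ z ∈ (T.neighborFinset v).erase x, gammaFree T (branch T v z) z ≤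
      ∑ z ∈ (T.neighborFinset v).erase x, (D.toLeft ∩ branch T v z).card := by
    refine Finset.sum_le_sum fun z hz => ?_
    rw [Finset.mem_erase, SimpleGraph.mem_neighborFinset] at hz
    exact gammaFree_le_card hT hz.2 (hav₁ z hz.2 hz.1) hD
  have hle : ∀ z ∈ (T.neighborFinset x).erase v,
      gammaFree T (branch T x z) z ≤ (D.toLeft ∩ branch T x z).card := fun z hz =>
    gammaFree_le_card hT (hN z hz).2 (hav₂ z (hN z hz).2 (hN z hz).1) hD
  have hsum₂ := Finset.sum_le_sum hle
  have hfree := gammaFree_branch_le hT hx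
  have hm₁ : s(v, x) ∈ ({s(v, x), s(x, y)} : Finset (Sym2 V)) := by simp
  have hm₂ : s(x, y) ∈ ({s(v, x), s(x, y)} : Finset (Sym2 V)) := by simp
  have hpos : ∀ e, Sum.inr e ∈ D → 0 < D.toRight.card := fun e he =>
    Finset.card_pos.2 ⟨e, Finset.mem_toRight.2 he⟩
  by_cases hs : Sum.inr ⟨s(x, y), hm₂⟩ ∈ D
  · have := hpos _ hs
    rcases subdivision_vertex_cases hD hm₁ with h | h | h
    · have : 1 < D.toRight.card := Finset.one_lt_card.2
        ⟨_, Finset.mem_toRight.2 hs, _, Finset.mem_toRight.2 h, by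
          simp [hyv, hx.ne.symm]⟩
      omega
    · rw [if_pos h]
      omega
    · rw [if_pos (Finset.mem_toLeft.2 h)]
      omega
  · have hout : ¬ DominatedOutside D x y := by
      rintro (h | ⟨⟨e, he⟩, hye, h⟩)
      · exact h.2 hm₂
      · rcases Finset.mem_insert.1 he with rfl | he'
        · rcases Sym2.mem_iff.1 hye with h' | h'
          · exact hyv h'
          · exact hy.ne h'.symm
        · obtain rfl := Finset.mem_singleton.1 he'
          exact hs h
    have hlt := Finset.sum_lt_sum hle ⟨y, by simp [hy, hyv],
      hb.trans_le (gammaOn_le_card hT hy (hav₂ y hy hyv) hD hout)⟩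
    rcases subdivision_vertex_cases hD hm₁ with h | h | h
    · have := hpos _ h
      omega
    · rw [if_pos h]
      omega
    · rw [if_pos (Finset.mem_toLeft.2 h)]
      omega

lemma degree_le_two (hT : T.IsTree)
    (hA : ∀ F : Finset (Sym2 V), (F : Set (Sym2 V)) ⊆ T.edgeSet → F.card ≤ 2 →
      dominationNumber (subdivide T F) ≤ dominationNumber T)
    (hB : ∀ F : Finset (Sym2 V), (F : Set (Sym2 V)) ⊆ T.edgeSet → F.card = 3 →
      dominationNumber T < dominationNumber (subdivide T F)) (v : V) :
    (T.neighborFinset v).card ≤ 2 := by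
  by_contra! hdeg
  have hA' : ∀ X ⊆ T.neighborFinset v, X.card ≤ 2 →
      dominationNumber (subdivide T (X.image fun z => s(v, z))) ≤ dominationNumber T :=
    fun X hX hc => hA _ (image_edge_subset hX) (by rwa [card_image_edge])
  have hB' : ∀ X ⊆ T.neighborFinset v, X.card = 3 →
      dominationNumber T < dominationNumber (subdivide T (X.image fun z => s(v, z))) :=
    fun X hX hc => hB _ (image_edge_subset hX) (by rwa [card_image_edge])
  have hle₁ := fun x => gammaFree_le_gammaOn T (branch T v x) x
  have hle₂ := fun x => gammaOn_le_gammaRoot T (root_mem_branch (T := T) (v := v) (x := x))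
  by_cases h1 : ∃ x, T.Adj v x ∧ gammaFree T (branch T v x) x < gammaOn T (branch T v x)
  · obtain ⟨x₁, hx₁, hb⟩ := h1
    have hn₁ := (T.mem_neighborFinset _ _).2 hx₁
    by_cases h2 : ∃ x, T.Adj v x ∧ x ≠ x₁ ∧
        gammaFree T (branch T v x) x < gammaRoot T (branch T v x) x
    · obtain ⟨x₂, hx₂, hne, hc⟩ := h2
      -- Two edges already raise the number: at most `S + 1` before, at least `S + 2` after.
      have hl := add_two_le_dominationNumber_subdivide hT hx₁ hx₂ hne.symm hb hc
      have hu := dominationNumber_le_one_add hT v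
      have := hA' {x₁, x₂} (by
        intro z hz
        rcases Finset.mem_insert.1 hz with rfl | hz
        · exact hn₁
        · rw [Finset.mem_singleton.1 hz]
          simpa using hx₂) Finset.card_le_two
      omega
    · push Not at h2
      -- Degree at least 3 supplies three edges at `v` including `vx₁`. Subdividing them keeps the
      -- number at most `S + 1`, which it had already reached.
      obtain ⟨X, hxX, hX, hXc⟩ := Finset.exists_subsuperset_card_eq
        (Finset.singleton_subset_iff.2 hn₁) (by simp : ({x₁} : Finset V).card ≤ 3) hdeg
      have hu := dominationNumber_subdivide_le_of_edge hT hX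
        (Finset.singleton_subset_iff.1 hxX) fun z hz hzx =>
          (h2 z hz hzx).antisymm ((hle₁ z).trans (hle₂ z))
      have hl := add_one_le_dominationNumber hT (Or.inl ⟨x₁, hx₁, hb⟩)
      have := hB' X hX hXc
      omega
  · push Not at h1
    have hb : ∀ x, T.Adj v x → gammaOn T (branch T v x) = gammaFree T (branch T v x) x :=
      fun x hx => (h1 x hx).antisymm (hle₁ x)
    by_cases h2 : ∀ x, T.Adj v x → gammaFree T (branch T v x) x < gammaRoot T (branch T v x) x
    · obtain ⟨X, hX, hXc⟩ := Finset.exists_subset_card_eq hdeg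
      have hu := dominationNumber_subdivide_le_of_center (X := X) hT hb
      have hl := add_one_le_dominationNumber hT (Or.inr h2)
      have := hB' X hX hXc
      omega
    · push Not at h2
      obtain ⟨x, hx, hc⟩ := h2
      have hc := hc.antisymm ((hle₁ x).trans (hle₂ x))
      -- Here the number is at most `S`, while subdividing `vx` and a suitable `xy` brings it to at
      -- least `S + 1`.
      have hu := dominationNumber_le_sum hT
        (fun z hz => hb z ((T.mem_neighborFinset _ _).1 hz)) hx hc
      obtain ⟨y, hy, hyv, hlt⟩ := exists_gammaFree_lt_gammaOn hT hx hc
      have hl := add_one_le_dominationNumber_subdivide_path hT hx hy hyv hlt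
      have := hA {s(v, x), s(x, y)} (by
        intro e he
        simp only [Finset.coe_insert, Finset.coe_singleton, Set.mem_insert_iff,
          Set.mem_singleton_iff] at he
        rcases he with rfl | rfl
        · exact hx
        · exact hy) Finset.card_le_two
      omega

end

/-! ### Paths and their subdivisions -/

section

/-- Every third vertex of the walk, starting from the second, dominates its neighbours along the
walk. -/
lemma dominationNumber_le_of_walk {G : SimpleGraph V} {u w : V} (q : G.Walk u w)
    (hq : ∀ x, x ∈ q.support) : dominationNumber G ≤ q.length / 3 + 1 := by
  refine (dominationNumber_le
    (D := (Finset.range (q.length / 3 + 1)).image fun i => q.getVert (3 * i + 1)) ?_).trans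
    (Finset.card_image_le.trans (Finset.card_range _).le)
  intro x hx
  obtain ⟨n, rfl, hn⟩ := SimpleGraph.Walk.mem_support_iff_exists_getVert.1 (hq x)
  have hmem : q.getVert (3 * (n / 3) + 1) ∈
      (Finset.range (q.length / 3 + 1)).image fun i => q.getVert (3 * i + 1) :=
    Finset.mem_image_of_mem (fun i => q.getVert (3 * i + 1)) (Finset.mem_range.2 (by omega))
  have hne : q.getVert n ≠ q.getVert (3 * (n / 3) + 1) := fun h => hx (h ▸ hmem)
  refine ⟨_, hmem, ?_⟩
  obtain h | h | h : n % 3 = 0 ∨ n % 3 = 1 ∨ n % 3 = 2 := by omega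
  · have hn3 : 3 * (n / 3) + 1 = n + 1 := by omega
    rw [hn3] at hne ⊢
    rcases hn.lt_or_eq with hlt | rfl
    · exact q.adj_getVert_succ hlt
    -- Here the chosen position lies one past the end, where `getVert` returns the last vertex,
    -- namely the one in question.
    · exact (hne (by simp [q.getVert_of_length_le])).elim
  · exact (hne (by congr 1; omega)).elim
  · have hn3 : n = 3 * (n / 3) + 1 + 1 := by omega
    have ha := q.adj_getVert_succ (i := 3 * (n / 3) + 1) (by omega)
    rw [← hn3] at ha
    exact ha.symm

lemma exists_walk_subdivide {T : SimpleGraph V} (F : Finset (Sym2 V)) {u w : V}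
    (p : T.Walk u w) : ∃ q : (subdivide T F).Walk (Sum.inl u) (Sum.inl w),
      q.length = p.length + (p.edges.filter (· ∈ F)).length ∧
      (∀ x ∈ p.support, Sum.inl x ∈ q.support) ∧
      ∀ e : F, (e : Sym2 V) ∈ p.edges → Sum.inr e ∈ q.support := by
  induction p with
  | nil => exact ⟨SimpleGraph.Walk.nil, by simp⟩
  | @cons a b c hab p ih =>
    obtain ⟨q, hl, hs, he⟩ := ih
    by_cases h : s(a, b) ∈ F
    · have h1 : (subdivide T F).Adj (Sum.inl a) (Sum.inr ⟨s(a, b), h⟩) := Sym2.mem_mk_left a b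
      have h2 : (subdivide T F).Adj (Sum.inr ⟨s(a, b), h⟩) (Sum.inl b) := Sym2.mem_mk_right a b
      refine ⟨SimpleGraph.Walk.cons h1 (SimpleGraph.Walk.cons h2 q), ?_, ?_, ?_⟩
      · simp [hl, h]
        omega
      · intro x hx
        rw [SimpleGraph.Walk.support_cons, List.mem_cons] at hx
        rcases hx with rfl | hx
        · simp
        · simp [hs x hx]
      · intro e hep
        rw [SimpleGraph.Walk.edges_cons, List.mem_cons] at hep
        rcases hep with hep | hep
        · have : e = ⟨s(a, b), h⟩ := Subtype.ext hep
          simp [this]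
        · simp [he e hep]
    · have h1 : (subdivide T F).Adj (Sum.inl a) (Sum.inl b) := ⟨hab, h⟩
      refine ⟨SimpleGraph.Walk.cons h1 q, ?_, ?_, ?_⟩
      · simp [hl, h]
        omega
      · intro x hx
        rw [SimpleGraph.Walk.support_cons, List.mem_cons] at hx
        rcases hx with rfl | hx
        · simp
        · simp [hs x hx]
      · intro e hep
        rw [SimpleGraph.Walk.edges_cons, List.mem_cons] at hep
        rcases hep with hep | hep
        · exact (h (hep ▸ e.2)).elim
        · simp [he e hep]

variable [Fintype V]

/-- Each vertex dominates at most three vertices, itself included. -/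
lemma card_le_three_mul_dominationNumber {G : SimpleGraph V}
    (hG : ∀ v, (G.neighborFinset v).card ≤ 2) : Fintype.card V ≤ 3 * dominationNumber G := by
  obtain ⟨D, hD, hc⟩ := exists_isDominating_card_eq G
  have hcover : (Finset.univ : Finset V) ⊆ D.biUnion fun d => insert d (G.neighborFinset d) := by
    intro v _
    rw [Finset.mem_biUnion]
    by_cases hv : v ∈ D
    · exact ⟨v, hv, Finset.mem_insert_self _ _⟩
    · obtain ⟨w, hw, ha⟩ := hD v hv
      exact ⟨w, hw, Finset.mem_insert_of_mem ((G.mem_neighborFinset _ _).2 ha.symm)⟩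
  have h := (Finset.card_le_card hcover).trans (Finset.card_biUnion_le_card_mul D _ 3 fun d _ =>
    (Finset.card_insert_le _ _).trans (Nat.add_le_add_right (hG d) 1))
  rw [Finset.card_univ] at h
  omega

lemma card_neighborFinset_subdivide_le_two {T : SimpleGraph V}
    (hd : ∀ v, (T.neighborFinset v).card ≤ 2) {F : Finset (Sym2 V)}
    (hF : (F : Set (Sym2 V)) ⊆ T.edgeSet) (z : V ⊕ F) :
    ((subdivide T F).neighborFinset z).card ≤ 2 := by
  rcases z with v | ⟨e, he⟩
  · let slot : V → V ⊕ F := fun w => if h : s(v, w) ∈ F then Sum.inr ⟨s(v, w), h⟩ else Sum.inl w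
    have hsub : (subdivide T F).neighborFinset (Sum.inl v) ⊆ (T.neighborFinset v).image slot := by
      intro z hz
      rw [SimpleGraph.mem_neighborFinset] at hz
      rw [Finset.mem_image]
      rcases z with w | ⟨e, he⟩
      · have hz : T.Adj v w ∧ s(v, w) ∉ F := hz
        exact ⟨w, (T.mem_neighborFinset _ _).2 hz.1, dif_neg hz.2⟩
      · have hz : v ∈ e := hz
        obtain ⟨w, rfl⟩ := Sym2.mem_iff_exists.1 hz
        exact ⟨w, (T.mem_neighborFinset _ _).2 (hF he), dif_pos he⟩
    exact (Finset.card_le_card hsub).trans (Finset.card_image_le.trans (hd v))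
  · induction e using Sym2.ind with
    | _ a b =>
      have hsub : (subdivide T F).neighborFinset (Sum.inr ⟨s(a, b), he⟩) ⊆
          {Sum.inl a, Sum.inl b} := by
        intro z hz
        rw [SimpleGraph.mem_neighborFinset] at hz
        rcases z with w | f
        · have hz : w ∈ s(a, b) := hz
          rcases Sym2.mem_iff.1 hz with rfl | rfl <;> simp
        · exact hz.elim
      exact (Finset.card_le_card hsub).trans Finset.card_le_two

lemma exists_isHamiltonian {T : SimpleGraph V} (hT : T.Connected)
    (hd : ∀ v, (T.neighborFinset v).card ≤ 2) : ∃ u w, ∃ p : T.Walk u w, p.IsHamiltonian := by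
  have := hT.nonempty
  -- If a longest path missed a vertex, connectivity would give an edge leaving it. At an end this
  -- extends the path; at an inner vertex it is a third edge.
  obtain ⟨u, w, p, hp, hmax⟩ := SimpleGraph.Walk.exists_isPath_forall_isPath_length_le_length T
  refine ⟨u, w, p, hp.isHamiltonian_iff.2 ?_⟩
  by_contra! hx
  obtain ⟨x, hx⟩ := hx
  obtain ⟨r⟩ := hT.preconnected u x
  obtain ⟨d, -, hd₁, hd₂⟩ := r.exists_boundary_dart {y | y ∈ p.support} p.start_mem_support hx
  have hadj := d.adj
  obtain ⟨n, hn, hnl⟩ := SimpleGraph.Walk.mem_support_iff_exists_getVert.1 hd₁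
  generalize d.fst = a at hadj hn hd₁
  generalize d.snd = b at hadj hd₂
  rcases Nat.eq_zero_or_pos n with rfl | hpos
  · rw [p.getVert_zero] at hn
    subst hn
    have := hmax _ _ (SimpleGraph.Walk.cons hadj.symm p) (hp.cons hd₂)
    simp at this
  rcases hnl.lt_or_eq with hlt | rfl
  · obtain ⟨m, rfl⟩ : ∃ m, n = m + 1 := ⟨n - 1, by omega⟩
    have h1 := p.adj_getVert_succ (i := m) (by omega)
    have h2 := p.adj_getVert_succ (i := m + 1) hlt
    rw [hn] at h1 h2
    have hsub : ({p.getVert m, p.getVert (m + 1 + 1), b} : Finset V) ⊆ T.neighborFinset a := by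
      intro y hy
      simp only [Finset.mem_insert, Finset.mem_singleton] at hy
      rw [SimpleGraph.mem_neighborFinset]
      rcases hy with rfl | rfl | rfl
      · exact h1.symm
      · exact h2
      · exact hadj
    have hne : ∀ i, p.getVert i ≠ b := fun i h => hd₂ (h ▸ p.getVert_mem_support i)
    have hne' : p.getVert m ≠ p.getVert (m + 1 + 1) := fun h => by
      have : m ≤ p.length := by omega
      have := hp.getVert_injOn (by simpa using this) (by simpa using hlt) h
      omega
    have := (Finset.card_le_card hsub).trans (hd a)
    rw [Finset.card_eq_three.2 ⟨_, _, _, hne', hne _, hne _, rfl⟩] at this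
    omega
  · rw [p.getVert_length] at hn
    subst hn
    have := hmax _ _ (p.concat hadj) (hp.concat hd₂ hadj)
    simp at this

/-- A Hamiltonian path has one edge fewer than it has vertices, as many as the tree has. -/
lemma mem_edges_of_isHamiltonian {T : SimpleGraph V} (hT : T.IsTree) {u w : V}
    {p : T.Walk u w} (hp : p.IsHamiltonian) {e : Sym2 V} (he : e ∈ T.edgeSet) : e ∈ p.edges := by
  have hsub : p.edges.toFinset ⊆ T.edgeFinset := fun f hf =>
    SimpleGraph.mem_edgeFinset.2 (p.edges_subset_edgeSet (List.mem_toFinset.1 hf))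
  have hcard : T.edgeFinset.card ≤ p.edges.toFinset.card := by
    have h1 := hT.card_edgeFinset
    have h2 := hp.length_eq
    rw [List.toFinset_card_of_nodup
      (SimpleGraph.Walk.edges_nodup_of_support_nodup hp.isPath.support_nodup), p.length_edges]
    omega
  exact List.mem_toFinset.1 (Finset.eq_of_subset_of_card_le hsub hcard ▸
    SimpleGraph.mem_edgeFinset.2 he)

lemma nonempty_iso_pathGraph {T : SimpleGraph V} (hT : T.IsTree)
    (hd : ∀ v, (T.neighborFinset v).card ≤ 2) :
    Nonempty (T ≃g SimpleGraph.pathGraph (Fintype.card V)) := by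
  obtain ⟨u, w, p, hp⟩ := exists_isHamiltonian hT.connected hd
  have htop : p.toSubgraph = ⊤ := by
    ext x y
    · simp [hp.mem_support]
    · rw [SimpleGraph.Subgraph.top_adj]
      refine ⟨fun h => h.adj_sub, fun h => ?_⟩
      exact (SimpleGraph.Walk.mem_edges_toSubgraph p).2 (mem_edges_of_isHamiltonian (e := s(x, y)) hT hp h)
  have hl : p.length + 1 = Fintype.card V := by
    rw [← p.length_support, hp.length_support]
  rw [← hl]
  have i := hp.isPath.pathGraphIsoToSubgraph
  rw [htop] at i
  exact ⟨(i.trans SimpleGraph.Subgraph.topIso).symm⟩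

lemma dominationNumber_subdivide_le {T : SimpleGraph V} (hT : T.IsTree)
    (hd : ∀ v, (T.neighborFinset v).card ≤ 2) {F : Finset (Sym2 V)}
    (hF : (F : Set (Sym2 V)) ⊆ T.edgeSet) :
    dominationNumber (subdivide T F) ≤ (Fintype.card V + F.card + 2) / 3 := by
  obtain ⟨u, w, p, hp⟩ := exists_isHamiltonian hT.connected hd
  obtain ⟨q, hl, hs, he⟩ := exists_walk_subdivide F p
  have hq : ∀ z, z ∈ q.support := by
    rintro (x | e)
    · exact hs x (hp.mem_support x)
    · exact he e (mem_edges_of_isHamiltonian hT hp (hF e.2))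
  have h1 := dominationNumber_le_of_walk q hq
  have h2 : (p.edges.filter (· ∈ F)).length ≤ F.card := by
    rw [← List.toFinset_card_of_nodup ((SimpleGraph.Walk.edges_nodup_of_support_nodup
      hp.isPath.support_nodup).filter _)]
    exact Finset.card_le_card fun e he => by simpa using (List.mem_filter.1
      (List.mem_toFinset.1 he)).2
  have h3 : p.length + 1 = Fintype.card V := by
    rw [← p.length_support, hp.length_support]
  omega

lemma dominationNumber_subdivide_eq {T : SimpleGraph V} (hT : T.IsTree)
    (hd : ∀ v, (T.neighborFinset v).card ≤ 2) {F : Finset (Sym2 V)}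
    (hF : (F : Set (Sym2 V)) ⊆ T.edgeSet) :
    dominationNumber (subdivide T F) = (Fintype.card V + F.card + 2) / 3 := by
  have h1 := dominationNumber_subdivide_le hT hd hF
  have h2 := card_le_three_mul_dominationNumber (card_neighborFinset_subdivide_le_two hd hF)
  rw [Fintype.card_sum, Fintype.card_coe] at h2
  omega

lemma dominationNumber_eq {T : SimpleGraph V} (hT : T.IsTree)
    (hd : ∀ v, (T.neighborFinset v).card ≤ 2) :
    dominationNumber T = (Fintype.card V + 2) / 3 := by
  obtain ⟨u, w, p, hp⟩ := exists_isHamiltonian hT.connected hd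
  have h1 := dominationNumber_le_of_walk p hp.mem_support
  have h2 := card_le_three_mul_dominationNumber hd
  have h3 : p.length + 1 = Fintype.card V := by
    rw [← p.length_support, hp.length_support]
  omega

lemma card_neighborFinset_le_two_of_iso {T : SimpleGraph V} {n : ℕ}
    (f : T ≃g SimpleGraph.pathGraph n) (v : V) : (T.neighborFinset v).card ≤ 2 := by
  have hinj : Function.Injective fun w => (f w : ℕ) := Fin.val_injective.comp f.injective
  rw [← Finset.card_image_of_injective _ hinj]
  refine (Finset.card_le_card (t := {(f v : ℕ) - 1, (f v : ℕ) + 1}) ?_).trans Finset.card_le_two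
  intro m hm
  obtain ⟨w, hw, rfl⟩ := Finset.mem_image.1 hm
  have ha := f.map_adj_iff.2 ((T.mem_neighborFinset _ _).1 hw)
  rw [SimpleGraph.pathGraph_adj] at ha
  simp only [Finset.mem_insert, Finset.mem_singleton]
  omega

/-! ### The two implications -/

lemma exists_edges_card {T : SimpleGraph V} (hT : T.IsTree) {m : ℕ}
    (hm : m + 1 ≤ Fintype.card V) :
    ∃ F : Finset (Sym2 V), (F : Set (Sym2 V)) ⊆ T.edgeSet ∧ F.card = m := by
  have h := hT.card_edgeFinset
  obtain ⟨F, hF, hc⟩ := Finset.exists_subset_card_eq (by omega : m ≤ T.edgeFinset.card)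
  exact ⟨F, fun e he => SimpleGraph.mem_edgeFinset.1 (hF he), hc⟩

lemma exists_iso_of_isCritical {T : SimpleGraph V} (hT : T.IsTree) (hcrit : IsCritical T 3)
    (hsd : sd T = 3) : ∃ k : ℕ, 1 ≤ k ∧ Nonempty (T ≃g SimpleGraph.pathGraph (3 * k + 1)) := by
  obtain ⟨⟨-, ⟨F₃, hF₃, hc₃⟩, hB⟩, -⟩ := hcrit
  have hA : ∀ F : Finset (Sym2 V), (F : Set (Sym2 V)) ⊆ T.edgeSet → F.card ≤ 2 →
      dominationNumber (subdivide T F) ≤ dominationNumber T := by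
    intro F hF hc
    by_contra! hlt
    have : sd T ≤ F.card := Nat.sInf_le ⟨F, hF, rfl, hlt⟩
    omega
  have hd := degree_le_two hT hA hB
  have h3 : F₃.card ≤ T.edgeFinset.card :=
    Finset.card_le_card fun e he => SimpleGraph.mem_edgeFinset.2 (hF₃ he)
  have hn := hT.card_edgeFinset
  have key : ∀ m ≤ 2, (Fintype.card V + m + 2) / 3 ≤ (Fintype.card V + 2) / 3 := by
    intro m hm
    obtain ⟨F, hF, rfl⟩ := exists_edges_card hT (m := m) (by omega)
    have := hA F hF hm
    rwa [dominationNumber_subdivide_eq hT hd hF, dominationNumber_eq hT hd] at this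
  -- That two subdivisions leave `⌈n/3⌉` unchanged forces `n ≡ 1 (mod 3)`.
  have h2 := key 2 le_rfl
  have hk : Fintype.card V = 3 * (Fintype.card V / 3) + 1 := by omega
  refine ⟨Fintype.card V / 3, by omega, ?_⟩
  rw [← hk]
  exact nonempty_iso_pathGraph hT hd

lemma isCritical_and_sd_of_iso {T : SimpleGraph V} (hT : T.IsTree) {k : ℕ} (hk : 1 ≤ k)
    (f : T ≃g SimpleGraph.pathGraph (3 * k + 1)) : IsCritical T 3 ∧ sd T = 3 := by
  have hd := card_neighborFinset_le_two_of_iso f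
  have hn : Fintype.card V = 3 * k + 1 := by
    rw [Fintype.card_congr f.toEquiv, Fintype.card_fin]
  have hlt : ∀ F : Finset (Sym2 V), (F : Set (Sym2 V)) ⊆ T.edgeSet →
      dominationNumber T < dominationNumber (subdivide T F) → 3 ≤ F.card := by
    intro F hF h
    rw [dominationNumber_subdivide_eq hT hd hF, dominationNumber_eq hT hd] at h
    omega
  have hraise : ∀ F : Finset (Sym2 V), (F : Set (Sym2 V)) ⊆ T.edgeSet → F.card = 3 →
      dominationNumber T < dominationNumber (subdivide T F) := by
    intro F hF h
    rw [dominationNumber_subdivide_eq hT hd hF, dominationNumber_eq hT hd]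
    omega
  obtain ⟨F₃, hF₃, hc₃⟩ := exists_edges_card hT (m := 3) (by omega)
  refine ⟨⟨⟨by norm_num, ⟨F₃, hF₃, hc₃⟩, hraise⟩, ?_⟩, ?_⟩
  · rintro n ⟨-, ⟨F, hF, rfl⟩, h⟩
    exact hlt F hF (h F hF rfl)
  · have hleast : IsLeast {n | ∃ F : Finset (Sym2 V), (F : Set (Sym2 V)) ⊆ T.edgeSet ∧
        F.card = n ∧ dominationNumber T < dominationNumber (subdivide T F)} 3 := by
      refine ⟨⟨F₃, hF₃, hc₃, hraise F₃ hF₃ hc₃⟩, ?_⟩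
      rintro n ⟨F, hF, rfl, h⟩
      exact hlt F hF h
    exact hleast.csInf_eq

end

end DomSubdiv

theorem mainTheorem5 {V : Type*} [Finite V] (T : SimpleGraph V) (hT : T.IsTree) :
    (DomSubdiv.IsCritical T 3 ∧ DomSubdiv.sd T = 3) ↔
      ∃ k : ℕ, 1 ≤ k ∧ Nonempty (T ≃g SimpleGraph.pathGraph (3 * k + 1)) := by
  have := Fintype.ofFinite V
  constructor
  · rintro ⟨hcrit, hsd⟩
    exact DomSubdiv.exists_iso_of_isCritical hT hcrit hsd
  · rintro ⟨k, hk, ⟨f⟩⟩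
    exact DomSubdiv.isCritical_and_sd_of_iso hT hk f
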